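/- Let $\mathcal V$ be a finite set of agents and let $K>1$ be a prediction horizon. Each agent $v\in\mathcal V$ has scalar decoupled dynamics $x^v_{t+1}=A^v x^v_t+B^v u^v_t$ with $A^v,B^v\in\mathbb R$, a stage cost $$\ell^v(x^v,u^v,u^{-v})=W^v (x^v)^2+w^v x^v+\ell_u^v(u^v,u^{-v}),\qquad W^v,w^v\in\mathbb R,$$ and at every stage the constraints $u^v\in\mathcal U^v\subseteq\mathbb R$ and $u=(u^v,u^{-v})\in\mathcal C\subseteq\mathbb R^{\mathcal V}$. Put $\mathcal Z=\prod_v\mathcal U^v\cap\mathcal C$. For a state $\mathbf x\in\mathbb R^{\mathcal V}$ and input sequences $u=(u^v)_{v}$, $u^v=(u^v_k)_{0\le k<K}\in\mathbb R^K$, let $J^v(u,\mathbf x)=\sum_{k=0}^{K-1}\ell^v(x^v_k,u^v_k,u^{-v}_k)$, where $x^v_0=\mathbf x^v$ and $x^v_{k+1}=A^vx^v_k+B^vu^v_k$, and let $F(u,\mathbf x)=\mathrm{col}(\nabla_{u^v}J^v(u,\mathbf x))_{v}$. Let $\mathcal Z_K$ be the set of all $u$ with $(u^v_k)_v\in\mathcal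 Z$ for every $k$, let $\mathcal N_{\mathcal Z_K}$ be its normal cone, and let $\mathcal S(\mathbf x)=\{u: 0\in F(u,\mathbf x)+\mathcal N_{\mathcal Z_K}(u)\}$ be the set of variational generalized Nash equilibria at $\mathbf x$. When $\mathcal S(\mathbf x)=\{u^*\}$, the receding-horizon feedback law is $\kappa(\mathbf x)=(u^{*,v}_0)_{v}$, and the closed loop is $x^v_{t+1}=A^vx^v_t+B^v\kappa(x_t)^v$ for all $v$. Assume: $|A^v|<1$ for all $v$; $\mathcal C$ and all $\mathcal U^v$ are closed and convex; $\mathcal Z$ is compact and non-empty; each $\ell^v_u$ is continuous and, for every fixed $u^{-v}$, $\ell_u^v(\cdot,u^{-v})$ is strongly convex and continuously differentiable; and, for some $\mu>0$, $F(\cdot,\mathbf x)$ is $\mu$-strongly monotone on the whole space for every $\mathbf x$. Suppose that for every $v\in\mathcal V$ there exist $\lambda_1^v\ge0$ and $\lambda_2^v\ge0$ such that at least one of the following holds: (a) $W^v\ge 0$, $\lambda_1^v>0$, $\mu>\frac{(B^v)^2}{\lambda_1^v}>0$ and $$\frac{\mu\lambda_1^v(A^v)^2}{\mu\lambda_1^v-(B^v)^2}+\frac{\lambda_1^v(B^v)^2(W^v)^2}{\mu}\sum_{k=0}^{K-2}\big((k+1)(A^v)^k\big)^2<1;$$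 (b) $\lambda_2^v>(B^v)^2>0$ and $$\frac{(A^v)^2\lambda_2^v}{\lambda_2^v-(B^v)^2}+\frac{4\lambda_2^v(B^v)^2(W^v)^2}{\mu^2}\sum_{k=0}^{K-2}\big((k+1)(A^v)^k\big)^2<1.$$ Then $\mathcal S(\mathbf x)$ is a singleton for every $\mathbf x\in\mathbb R^{\mathcal V}$, so that the closed loop is well defined, and: (i) the closed loop has a globally asymptotically stable equilibrium point $\bar x\in\mathbb R^{\mathcal V}$, that is, $\bar x$ is a fixed point of the closed loop and there is a class-$\mathcal{KL}$ function $\beta$ with $\|x_t-\bar x\|\le\beta(\|x_0-\bar x\|,t)$ for all $x_0$ and all $t\in\mathbb N$; (ii) the finite-horizon optimal control problems are recursively feasible from every initial state: along the closed loop started at any $x_0\in\mathbb R^{\mathcal V}$, at every time $t$ the equilibrium $u^*$ of the game at $x_t$ gives, for every agent $v$, a feasible point (own inputs $u^{*,v}$ with a predicted trajectory) of the problem of agent $v$ given the inputs $u^{*,-v}$ of the other agents; (iii) $\kappa(x_t)\in\mathcal Z$ for all $t$ and every initial state $x_0$. -/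

import Mathlib

/-! Receding horizon games with decoupled scalar dynamics. -/

/-- Comparison functions of class `𝓚𝓛`: `β : [0,∞) × [0,∞) → [0,∞)` is continuous,
`β(·,t)` is strictly increasing with `β(0,t) = 0`, and `β(r,·)` is strictly decreasing to `0` for
every `r > 0`. -/
structure IsClassKL (β : ℝ → ℝ → ℝ) : Prop where
  nonneg : ∀ r t, 0 ≤ r → 0 ≤ t → 0 ≤ β r t
  continuousOn : ContinuousOn (fun p : ℝ × ℝ => β p.1 p.2) (Set.Ici 0 ×ˢ Set.Ici 0)
  zero : ∀ t, 0 ≤ t → β 0 t = 0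
  strictMonoOn : ∀ t, 0 ≤ t → StrictMonoOn (fun r => β r t) (Set.Ici 0)
  strictAntiOn : ∀ r, 0 < r → StrictAntiOn (fun t => β r t) (Set.Ici 0)
  tendsto_zero : ∀ r, 0 < r → Filter.Tendsto (fun t => β r t) Filter.atTop (nhds 0)

/-- `xbar` is a globally asymptotically stable equilibrium point of `x⁺ = f x`. -/
def IsGloballyAsymptoticallyStable {E : Type*} [NormedAddCommGroup E] (f : E → E) (xbar : E) :
    Prop :=
  f xbar = xbar ∧
    ∃ β : ℝ → ℝ → ℝ, IsClassKL β ∧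
      ∀ (x₀ : E) (t : ℕ), ‖f^[t] x₀ - xbar‖ ≤ β ‖x₀ - xbar‖ t

/-- The normal cone of `S` at `u` (empty when `u ∉ S`). -/
def normalConeAt {E : Type*} [NormedAddCommGroup E] [InnerProductSpace ℝ E] (S : Set E) (u : E) :
    Set E :=
  {g | u ∈ S ∧ ∀ y ∈ S, inner ℝ g (y - u) ≤ 0}

/-- `T` is `μ`-strongly monotone on the whole space. -/
def IsStronglyMonotone {E : Type*} [NormedAddCommGroup E] [InnerProductSpace ℝ E] (μ : ℝ)
    (T : E → E) : Prop :=
  0 < μ ∧ ∀ x y : E, μ * ‖x - y‖ ^ 2 ≤ inner ℝ (x - y) (T x - T y)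

/-- The data of a game between agents `v : V` with scalar decoupled dynamics
`xᵛ⁺ = Aᵛ xᵛ + Bᵛ uᵛ`, stage costs `Wᵛ (xᵛ)² + wᵛ xᵛ + ℓᵤᵛ(u)`, local input constraint sets `Uᵛ`
and a coupling constraint set `C`. -/
structure ScalarGame (V : Type*) where
  A : V → ℝ
  B : V → ℝ
  W : V → ℝ
  w : V → ℝ
  ell : V → (V → ℝ) → ℝ
  U : V → Set ℝ
  C : Set (V → ℝ)

/-- Strategy profiles over the horizon `K`: one input sequence in `ℝᴷ` for each agent, with the
Euclidean inner product. -/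
abbrev Profile (V : Type*) (K : ℕ) : Type _ := PiLp 2 (fun _ : V => EuclideanSpace ℝ (Fin K))

namespace ScalarGame

variable {V : Type*} (G : ScalarGame V)

/-- The set of admissible joint inputs at one stage. -/
def Z : Set (V → ℝ) := {z | (∀ v, z v ∈ G.U v) ∧ z ∈ G.C}

/-- The joint input of all agents at stage `k` of a strategy profile. -/
def stageInput {K : ℕ} (u : Profile V K) (k : Fin K) : V → ℝ := fun v => u v k

/-- The admissible strategy profiles over the horizon. -/
def horizonZ (K : ℕ) : Set (Profile V K) := {u | ∀ k, stageInput u k ∈ G.Z}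

/-- Predicted state of agent `v` after `k ≤ K` steps, from the local state `a` under the input
sequence `s`. -/
noncomputable def predState {K : ℕ} (v : V) (a : ℝ) (s : EuclideanSpace ℝ (Fin K)) : ℕ → ℝ
  | 0 => a
  | k + 1 => G.A v * predState v a s k + G.B v * (if h : k < K then s ⟨k, h⟩ else 0)

variable [Fintype V]

/-- Cost of agent `v` over the horizon with the dynamics substituted:
`∑ k < K, Wᵛ (xᵛₖ)² + wᵛ xᵛₖ + ℓᵤᵛ(uₖ)`. -/
noncomputable def J {K : ℕ} (v : V) (u : Profile V K) (x : EuclideanSpace ℝ V) : ℝ :=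
  ∑ k : Fin K, (G.W v * G.predState v (x v) (u v) k ^ 2 + G.w v * G.predState v (x v) (u v) k
    + G.ell v (stageInput u k))

/-- The feasible set of the optimal control problem of agent `v` at the state `x`, given the input
sequences of the other agents in `u` (the entry `u v` plays no role): pairs of an own input
sequence and a predicted local state trajectory satisfying all constraints. -/
def ocpFeasibleSet [DecidableEq V] {K : ℕ} (v : V) (x : EuclideanSpace ℝ V) (u : Profile V K) :
    Set (EuclideanSpace ℝ (Fin K) × (Fin (K + 1) → ℝ)) :=
  {p | p.2 0 = x v ∧
    ∀ k : Fin K,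
      p.2 k.succ = G.A v * p.2 k.castSucc + G.B v * p.1 k ∧
      p.1 k ∈ G.U v ∧
      stageInput (WithLp.toLp 2 (Function.update u.ofLp v p.1) : Profile V K) k ∈ G.C}

/-- The pseudo-gradient `F(u, x) = col(∇_{uᵛ} Jᵛ(uᵛ, u⁻ᵛ, x))`. -/
noncomputable def pseudoGradient [DecidableEq V] {K : ℕ} (u : Profile V K)
    (x : EuclideanSpace ℝ V) : Profile V K :=
  WithLp.toLp 2 (fun v =>
    gradient (fun a : EuclideanSpace ℝ (Fin K) =>
      G.J v (WithLp.toLp 2 (Function.update u.ofLp v a)) x) (u v))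

/-- The set of variational generalized Nash equilibria at the state `x`: the solutions `u` of
`0 ∈ F(u, x) + N_Z(u)`. -/
def solutionSet [DecidableEq V] (K : ℕ) (x : EuclideanSpace ℝ V) : Set (Profile V K) :=
  {u | ∃ g ∈ normalConeAt (G.horizonZ K) u, G.pseudoGradient u x + g = 0}

/-- The variational equilibrium at `x` (a selection of `solutionSet`, arbitrary if that is empty). -/
noncomputable def vGNE [DecidableEq V] (K : ℕ) (x : EuclideanSpace ℝ V) : Profile V K :=
  Classical.epsilon (fun u => u ∈ G.solutionSet K x)

/-- The receding horizon feedback law: the first inputs of the variational equilibrium at `x`. -/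
noncomputable def feedback [DecidableEq V] (K : ℕ) [NeZero K] (x : EuclideanSpace ℝ V) : V → ℝ :=
  stageInput (G.vGNE K x) 0

/-- One step of the closed loop. -/
noncomputable def closedLoop [DecidableEq V] (K : ℕ) [NeZero K] (x : EuclideanSpace ℝ V) :
    EuclideanSpace ℝ V :=
  WithLp.toLp 2 (fun v => G.A v * x v + G.B v * G.feedback K x v)

/-- The standing assumptions on the game with horizon `K` and monotonicity constant `μ`. -/
structure StandingAssumptions [DecidableEq V] (K : ℕ) (μ : ℝ) : Prop where
  /-- the spectral radius of `diag(Aᵛ)` is less than one -/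
  stable : ∀ v, |G.A v| < 1
  isClosed_C : IsClosed G.C
  convex_C : Convex ℝ G.C
  isClosed_U : ∀ v, IsClosed (G.U v)
  convex_U : ∀ v, Convex ℝ (G.U v)
  isCompact_Z : IsCompact G.Z
  nonempty_Z : G.Z.Nonempty
  continuous_ell : ∀ v, Continuous (G.ell v)
  strongConvex_ell : ∀ (v : V) (z : V → ℝ), ∃ m : ℝ, 0 < m ∧
    StrongConvexOn Set.univ m (fun a : ℝ => G.ell v (Function.update z v a))
  contDiff_ell : ∀ (v : V) (z : V → ℝ),
    ContDiff ℝ 1 (fun a : ℝ => G.ell v (Function.update z v a))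
  stronglyMonotone : ∀ x : EuclideanSpace ℝ V,
    IsStronglyMonotone μ (fun u : Profile V K => G.pseudoGradient u x)

end ScalarGame

/-! Stability is a contraction argument. Take states `x`, `x'` with equilibria `u`, `u'`. Testing
each variational inequality at the other equilibrium and adding strong monotonicity at `x'` bounds
`μ‖u - u'‖²` by the effect of the state on the pseudo-gradient. The dynamics are linear and the
state cost is quadratic, so this effect is an explicit vector: in block `v` it is `2 W B (x v - x'
v)` times the vector of `sensitivity`. Hence a sum over agents of `μ‖Δuᵛ‖² + 2 W B Δxᵛ ⟨c, Δuᵛ⟩` is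
nonpositive (`solutionSet_sensitivity`).

The conditions (a) and (b) each make `(A Δx + B Δu₀)² - (1 - ε) Δx²` at most `r > 0` times the
summand of that agent (`exists_agent_dissipation`). Dividing by `r` and summing shows that the
closed loop contracts the squared norm with weights `1 / r`; Banach's theorem then yields the
equilibrium and an exponential class-KL bound. The sum in the conditions enters as an upper bound
for `‖c‖²` (`sum_pow_mul_geom_sq_le`).

Existence of the variational equilibrium is Minty's argument on a compact convex set. It needs the
pseudo-gradient to be continuous, which follows from convexity in the own input
(`continuous_deriv_update`). Feasibility holds because every equilibrium lies in `horizonZ` and the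
states are unconstrained. -/

/-! ### Existence for monotone variational inequalities. -/

/-- A matrix whose symmetric part has nonnegative entries admits a mixed strategy with nonnegative
payoffs. -/
theorem exists_stdSimplex_sum_mul_nonneg {ι : Type*} [Fintype ι] [Nonempty ι] (a : ι → ι → ℝ)
    (ha : ∀ i j, 0 ≤ a i j + a j i) :
    ∃ p ∈ stdSimplex ℝ ι, ∀ i, 0 ≤ ∑ j, p j * a i j := by
  classical
  let T : (ι → ℝ) →ₗ[ℝ] (ι → ℝ) := Matrix.mulVecLin (Matrix.of a)
  have hT : ∀ p i, T p i = ∑ j, p j * a i j := fun p i => by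
    simp [T, Matrix.mulVec, dotProduct, mul_comm]
  by_contra! hcon
  -- If no such `p` exists, the image of the simplex can be separated from the nonnegative orthant.
  -- The separating functional `w` is nonnegative and nonzero; normalized, it is itself a mixed
  -- strategy, and its quadratic form is negative. That form only sees the symmetric part of `a`.
  have hdisj : Disjoint (T '' stdSimplex ℝ ι) (Set.Ici (0 : ι → ℝ)) := by
    rw [Set.disjoint_left]
    rintro _ ⟨p, hp, rfl⟩ hmem
    obtain ⟨i, hi⟩ := hcon p hp
    have := (Set.mem_Ici.1 hmem) i
    rw [hT] at this
    simp only [Pi.zero_apply] at this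
    linarith
  obtain ⟨f, u, v, hu, huv, hv⟩ := geometric_hahn_banach_compact_closed
    ((convex_stdSimplex ℝ ι).linear_image T)
    ((isCompact_stdSimplex ℝ ι).image T.continuous_of_finiteDimensional)
    (convex_Ici _) isClosed_Ici hdisj
  have hv0 : v < 0 := by simpa using hv 0 (Set.mem_Ici.2 le_rfl)
  set w : ι → ℝ := fun i => f (Pi.single i 1) with hw
  have hf : ∀ x : ι → ℝ, f x = ∑ i, w i * x i := fun x => by
    conv_lhs => rw [pi_eq_sum_univ' x]
    simp only [map_sum, map_smul, smul_eq_mul, hw]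
    refine Finset.sum_congr rfl fun i _ => ?_
    rw [mul_comm]
  have hw0 : ∀ i, 0 ≤ w i := fun i => by
    by_contra! hi
    have h1 := hv ((v / w i) • Pi.single i 1) (Set.mem_Ici.2 (smul_nonneg
      (div_nonneg_of_nonpos hv0.le hi.le) (by
        intro j; by_cases h : j = i <;> simp [h])))
    rw [map_smul, smul_eq_mul, div_mul_cancel₀ _ hi.ne] at h1
    exact lt_irrefl _ h1
  have key : ∀ p ∈ stdSimplex ℝ ι, ∑ i, w i * ∑ j, p j * a i j < 0 := fun p hp => by
    have := hu _ ⟨p, hp, rfl⟩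
    rw [hf] at this
    simp only [hT] at this
    linarith
  have hsum : 0 < ∑ i, w i := by
    refine (Finset.sum_nonneg fun i _ => hw0 i).lt_of_ne' fun h0 => ?_
    have hz := (Finset.sum_eq_zero_iff_of_nonneg fun i _ => hw0 i).1 h0
    have := key _ (single_mem_stdSimplex ℝ (Classical.arbitrary ι))
    simp [hz] at this
  have h1 := key (fun i => w i / ∑ i, w i) ⟨fun i => div_nonneg (hw0 i) hsum.le, by
    rw [← Finset.sum_div, div_self hsum.ne']⟩
  have h2 : ∑ i, w i * ∑ j, (w j / ∑ i, w i) * a i j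
      = (∑ i, ∑ j, w i * w j * a i j) / ∑ i, w i := by
    rw [Finset.sum_div]
    refine Finset.sum_congr rfl fun i _ => ?_
    rw [Finset.mul_sum, Finset.sum_div]
    refine Finset.sum_congr rfl fun j _ => ?_
    ring
  rw [h2, div_neg_iff] at h1
  have h3 : ∑ i, ∑ j, w i * w j * a i j < 0 := by
    rcases h1 with h | h
    · exact absurd hsum (not_lt.2 h.2.le)
    · exact h.1
  have h4 : ∑ i, ∑ j, w i * w j * a i j = ∑ i, ∑ j, w i * w j * a j i := by
    rw [Finset.sum_comm]
    refine Finset.sum_congr rfl fun i _ => Finset.sum_congr rfl fun j _ => by ring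
  have h5 : 0 ≤ ∑ i, ∑ j, w i * w j * (a i j + a j i) :=
    Finset.sum_nonneg fun i _ => Finset.sum_nonneg fun j _ =>
      mul_nonneg (mul_nonneg (hw0 i) (hw0 j)) (ha i j)
  simp only [mul_add, Finset.sum_add_distrib] at h5
  linarith

section VariationalInequality

variable {E : Type*} [NormedAddCommGroup E] [InnerProductSpace ℝ E]

/-- Minty's finite intersection property for monotone operators. -/
theorem exists_mem_forall_finset_inner_nonneg {S : Set E} (hS : Convex ℝ S) (hne : S.Nonempty)
    {F : E → E} (hF : ∀ x ∈ S, ∀ y ∈ S, 0 ≤ inner ℝ (F x - F y) (x - y)) (s : Finset S) :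
    ∃ u ∈ S, ∀ y ∈ s, 0 ≤ inner ℝ (F y) (y - u) := by
  rcases s.eq_empty_or_nonempty with rfl | hs
  · exact ⟨hne.some, hne.some_mem, by simp⟩
  have : Nonempty s := hs.to_subtype
  -- Monotonicity says exactly that this matrix has a symmetric part with nonnegative entries; the
  -- barycenter with weights `p` is the required point.
  obtain ⟨p, hp, hpos⟩ := exists_stdSimplex_sum_mul_nonneg
    (fun i j : s => inner ℝ (F (i : S)) (((i : S) : E) - ((j : S) : E))) fun i j => by
      have := hF (i : S) (i : S).2 (j : S) (j : S).2
      rw [inner_sub_left] at this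
      rw [← neg_sub ((i : S) : E) ((j : S) : E), inner_neg_right]
      linarith
  refine ⟨∑ j : s, p j • ((j : S) : E), hS.sum_mem (fun j _ => hp.1 j) hp.2
    fun j _ => (j : S).2, fun y hy => ?_⟩
  have h := hpos ⟨y, hy⟩
  have e : ((y : E) - ∑ j : s, p j • ((j : S) : E))
      = ∑ j : s, p j • ((y : E) - ((j : S) : E)) := by
    simp only [smul_sub, Finset.sum_sub_distrib]
    rw [← Finset.sum_smul, hp.2, one_smul]
  rw [e, inner_sum]
  simpa only [real_inner_smul_right] using h

/-- A continuous monotone operator on a nonempty compact convex set solves its variational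
inequality. -/
theorem exists_variationalInequality_solution {S : Set E} (hS : Convex ℝ S) (hc : IsCompact S)
    (hne : S.Nonempty) {F : E → E} (hcont : Continuous F)
    (hF : ∀ x ∈ S, ∀ y ∈ S, 0 ≤ inner ℝ (F x - F y) (x - y)) :
    ∃ u ∈ S, ∀ y ∈ S, 0 ≤ inner ℝ (F u) (y - u) := by
  obtain ⟨u, hu, hmin⟩ := hc.inter_iInter_nonempty
    (fun y : S => {u : E | 0 ≤ inner ℝ (F y) ((y : E) - u)})
    (fun y => isClosed_le continuous_const (by fun_prop)) fun s => by
      obtain ⟨u, hu, h⟩ := exists_mem_forall_finset_inner_nonneg hS hne hF s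
      exact ⟨u, hu, by simpa using h⟩
  refine ⟨u, hu, fun y hy => ?_⟩
  -- From Minty's inequality to the variational inequality: test at `u + t (y - u)`, divide by `t`
  -- and let `t → 0⁺`.
  have hlim : Filter.Tendsto (fun t : ℝ => inner ℝ (F (u + t • (y - u))) (y - u))
      (nhdsWithin 0 (Set.Ioi 0)) (nhds (inner ℝ (F u) (y - u))) := by
    have hc' : Continuous fun t : ℝ => inner ℝ (F (u + t • (y - u))) (y - u) := by fun_prop
    simpa using (hc'.tendsto 0).mono_left nhdsWithin_le_nhds
  refine ge_of_tendsto hlim ?_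
  filter_upwards [Ioo_mem_nhdsGT (zero_lt_one' ℝ)] with t ht
  have hm := Set.mem_iInter.1 hmin ⟨u + t • (y - u), hS.add_smul_sub_mem hu hy ⟨ht.1.le, ht.2.le⟩⟩
  simp only [Set.mem_ofPred_eq, add_sub_cancel_left, real_inner_smul_right] at hm
  exact nonneg_of_mul_nonneg_right hm ht.1

end VariationalInequality

/-! ### Bounds on geometric sums. -/

open Finset in
-- Raising `N` by one adds `q ^ (N - j)` to each inner sum, so the term `j` grows by at most `q ^ (N
-- + 1) * (2 * (N - j) + 1)`. These odd numbers add up to `(N + 1) ^ 2`. With `q = A²` the left side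
-- is the squared norm of the sensitivity vector.
theorem sum_pow_mul_geom_sq_le {q : ℝ} (hq : 0 ≤ q) (hq1 : q ≤ 1) (N : ℕ) :
    ∑ j ∈ range N, q ^ (j + 1) * (∑ i ∈ range (N - j), q ^ i) ^ 2
      ≤ ∑ k ∈ range N, ((k : ℝ) + 1) ^ 2 * q ^ k := by
  have hg : ∀ n : ℕ, ∑ i ∈ range n, q ^ i ≤ n := fun n => by
    simpa using sum_le_card_nsmul (range n) (fun i => q ^ i) 1 fun i _ => pow_le_one₀ hq hq1
  have hodd : ∀ n : ℕ, ∑ j ∈ range n, (2 * ((n - 1 - j : ℕ) : ℝ) + 1) = (n : ℝ) ^ 2 := fun n => by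
    rw [sum_range_reflect (fun j => 2 * (j : ℝ) + 1) n]
    induction n with
    | zero => simp
    | succ n ih => rw [sum_range_succ, ih]; push_cast; ring
  induction N with
  | zero => simp
  | succ N ih =>
    have h1 : ∑ j ∈ range (N + 1), q ^ (j + 1) * (∑ i ∈ range (N - j), q ^ i) ^ 2
        = ∑ j ∈ range N, q ^ (j + 1) * (∑ i ∈ range (N - j), q ^ i) ^ 2 := by
      rw [sum_range_succ]; simp
    have h2 : ∀ j ∈ range (N + 1), q ^ (j + 1) * (∑ i ∈ range (N + 1 - j), q ^ i) ^ 2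
        ≤ q ^ (j + 1) * (∑ i ∈ range (N - j), q ^ i) ^ 2
          + q ^ (N + 1) * (2 * ((N + 1 - 1 - j : ℕ) : ℝ) + 1) := fun j hj => by
      have hj' : j ≤ N := by simpa [Nat.lt_succ_iff] using hj
      rw [Nat.succ_sub hj', sum_range_succ, Nat.add_sub_cancel]
      have e : q ^ (N + 1) = q ^ (j + 1) * q ^ (N - j) := by
        rw [← pow_add]; congr 1; omega
      have h3 := hg (N - j)
      have h4 : q ^ (N - j) ≤ 1 := pow_le_one₀ hq hq1
      have h5 : 0 ≤ q ^ (N - j) := pow_nonneg hq _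
      have h6 : 0 ≤ q ^ (j + 1) := pow_nonneg hq _
      rw [e, mul_assoc, ← mul_add]
      refine mul_le_mul_of_nonneg_left ?_ h6
      nlinarith
    have h7 := sum_le_sum h2
    rw [sum_add_distrib, h1, ← mul_sum, hodd] at h7
    rw [sum_range_succ (fun k : ℕ => ((k : ℝ) + 1) ^ 2 * q ^ k)]
    have h8 : q ^ (N + 1) ≤ q ^ N := pow_le_pow_of_le_one hq hq1 (Nat.le_succ N)
    push_cast at h7
    nlinarith [sq_nonneg ((N : ℝ) + 1)]

open Finset in
theorem geom_sum_sq_le {q : ℝ} (hq : 0 ≤ q) (hq1 : q ≤ 1) (N : ℕ) :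
    (∑ i ∈ range N, q ^ i) ^ 2 ≤ ∑ k ∈ range N, ((k : ℝ) + 1) ^ 2 * q ^ k := by
  have hg : ∀ n : ℕ, ∑ i ∈ range n, q ^ i ≤ n := fun n => by
    simpa using sum_le_card_nsmul (range n) (fun i => q ^ i) 1 fun i _ => pow_le_one₀ hq hq1
  induction N with
  | zero => simp
  | succ N ih =>
    rw [sum_range_succ, sum_range_succ]
    have h3 := hg N
    have h4 : q ^ N ≤ 1 := pow_le_one₀ hq hq1
    have h5 : 0 ≤ q ^ N := pow_nonneg hq _
    nlinarith [mul_nonneg h5 (sq_nonneg (N : ℝ)), mul_le_mul_of_nonneg_left h3 h5,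
      mul_le_mul_of_nonneg_left h4 h5]

/-! ### Scalar dissipation inequalities. -/

/-- If the scalar stability condition has some multiplier `L`, then it has one for which the
cross term between state and first input is also dominated. -/
theorem exists_multiplier {A om g sig L : ℝ} (hom : 0 ≤ om) (hsig : 0 ≤ sig)
    (hA : |A| < 1) (hsg : om * sig ≤ g) (hos : om ≤ g) (hsA : sig * (1 - A ^ 2) ≤ 1)
    (hL : 1 < L) (hcond : A ^ 2 < (L - 1) * (1 - A ^ 2 - L * g ^ 2)) :
    ∃ ρ, 1 < ρ ∧ A ^ 2 < (ρ - 1) * (1 - A ^ 2 - ρ * g ^ 2) ∧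
      A ^ 2 * (ρ * om * sig - 1) ^ 2 ≤ A ^ 2 := by
  -- Here `L` itself works; the choice of `ρ` below needs both `A` and `g` nonzero.
  by_cases hz : om = 0 ∨ A = 0
  · refine ⟨L, hL, hcond, ?_⟩
    rcases hz with rfl | rfl <;> simp
  push Not at hz
  have hom' : 0 < om := hom.lt_of_ne' hz.1
  have hg : 0 < g := hom'.trans_le hos
  set c := |A| with hc
  have hc0 : 0 < c := abs_pos.2 hz.2
  have hAc : A ^ 2 = c ^ 2 := (sq_abs A).symm
  rw [hAc] at hcond hsA ⊢
  have hm : 0 < L - 1 := by linarith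
  -- By AM-GM, `(L - 1)² g² + c² ≥ 2 (L - 1) c g`, which removes `L` from the condition.
  have hcg : c + g < 1 := by
    have h1 : (L - 1) * (2 * c * g) < (L - 1) * (1 - c ^ 2 - g ^ 2) := by
      nlinarith [sq_nonneg ((L - 1) * g - c)]
    have h2 := lt_of_mul_lt_mul_left h1 hm.le
    nlinarith
  have hos1 : om * sig ≤ 1 := by
    have h1 : om ≤ 1 - c ^ 2 := by nlinarith
    nlinarith
  -- This `ρ` minimizes `c² / (ρ - 1) + ρ g²` over `ρ > 1`. It also gives `ρ om sig ≤ om sig + c ≤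
  -- 2`, which is what the cross term needs.
  refine ⟨1 + c / g, by have := div_pos hc0 hg; linarith, ?_, ?_⟩
  · have e : (1 + c / g - 1) * (1 - c ^ 2 - (1 + c / g) * g ^ 2)
        = c / g * (1 - c ^ 2 - g ^ 2 - c * g) := by field_simp; ring
    rw [e, div_mul_eq_mul_div, lt_div_iff₀ hg]
    have h1 : (c + g) ^ 2 < 1 := by nlinarith
    nlinarith [mul_pos hc0 (sub_pos.2 h1)]
  · have h0 : 0 ≤ (1 + c / g) * om * sig := by positivity
    have h1 : (1 + c / g) * om * sig ≤ 2 := by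
      have : c / g * (om * sig) ≤ c := by
        rw [div_mul_eq_mul_div, div_le_iff₀ hg]; nlinarith
      nlinarith
    have : ((1 + c / g) * om * sig - 1) ^ 2 ≤ 1 := by nlinarith
    nlinarith [sq_nonneg c]

/-- A quadratic form with positive leading coefficient and nonpositive discriminant. -/
theorem quadratic_form_nonneg {α β γ : ℝ} (hα : 0 < α) (h : β ^ 2 ≤ α * γ) (a b : ℝ) :
    0 ≤ α * b ^ 2 + 2 * β * a * b + γ * a ^ 2 := by
  have h1 : 0 ≤ α * (α * b ^ 2 + 2 * β * a * b + γ * a ^ 2) := by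
    nlinarith [sq_nonneg (α * b + β * a), mul_nonneg (sub_nonneg.2 h) (sq_nonneg a)]
  exact nonneg_of_mul_nonneg_right h1 hα

/-- For `W ≥ 0` the product of `a` and the first input `t` in the cost partly cancels the one in `(A
a + B t)²`: with `b = B t`, what remains is `2 A (ρ om sig - 1) a b`, where `ρ` can be chosen so
that this is no worse than having no contribution from the cost. Only the tail `T` is then estimated
by Cauchy-Schwarz. -/
theorem exists_dissipation_of_nonneg {A B W μ l S G sig : ℝ} (hμ : 0 < μ) (hA : |A| < 1)
    (hW : 0 ≤ W) (hl : 0 ≤ l) (h1 : μ > B ^ 2 / l) (h2 : B ^ 2 / l > 0)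
    (hG : 1 ≤ G) (hS : S ≤ G) (hsig : 0 ≤ sig) (hsG : sig ^ 2 ≤ G) (hsA : sig * (1 - A ^ 2) ≤ 1)
    (hcond : μ * l * A ^ 2 / (μ * l - B ^ 2) + l * B ^ 2 * W ^ 2 / μ * G < 1) :
    ∃ r ε : ℝ, 0 < r ∧ 0 < ε ∧ ∀ a t T Q : ℝ, T ^ 2 ≤ S * Q → 0 ≤ Q →
      (A * a + B * t) ^ 2 - (1 - ε) * a ^ 2
        ≤ r * (μ * (t ^ 2 + Q) + 2 * W * B * a * (A * sig * t + T)) := by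
  -- The case `l = 0` is excluded because division by zero gives `0`.
  have hl' : 0 < l := hl.lt_of_ne' (by rintro rfl; simp at h2)
  have hB : 0 < B ^ 2 := by
    by_contra! h
    exact absurd h2 (not_lt.2 (div_nonpos_of_nonpos_of_nonneg h hl))
  have hB0 : B ≠ 0 := by rintro rfl; simp at hB
  have hlB : B ^ 2 < μ * l := by rwa [gt_iff_lt, div_lt_iff₀ hl'] at h1
  have hG0 : 0 < G := by linarith
  set om := W * B ^ 2 / μ with hom
  have hom0 : 0 ≤ om := by positivity
  set g := om * √G with hg
  have hsq : √G ^ 2 = G := Real.sq_sqrt hG0.le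
  have hg2 : g ^ 2 = om ^ 2 * G := by rw [hg, mul_pow, hsq]
  -- In terms of `L` the condition reads `L A² / (L - 1) + L g² < 1`.
  set L := μ * l / B ^ 2 with hL
  have hL1 : 1 < L := by rwa [hL, one_lt_div hB]
  have hcondL : A ^ 2 < (L - 1) * (1 - A ^ 2 - L * g ^ 2) := by
    have e1 : μ * l * A ^ 2 / (μ * l - B ^ 2) = L * A ^ 2 / (L - 1) := by
      have h3 : μ * l - B ^ 2 ≠ 0 := by linarith
      have h4 : L - 1 ≠ 0 := by linarith
      have h5 : μ * l = L * B ^ 2 := by rw [hL]; field_simp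
      rw [h5, div_eq_div_iff (by rw [← h5]; exact h3) h4]; ring
    have e2 : l * B ^ 2 * W ^ 2 / μ * G = L * g ^ 2 := by
      rw [hg2, hL, hom]; field_simp
    rw [e1, e2] at hcond
    have hm : 0 < L - 1 := by linarith
    have h6 : L * A ^ 2 / (L - 1) < 1 - L * g ^ 2 := by linarith
    rw [div_lt_iff₀ hm] at h6
    nlinarith
  obtain ⟨ρ, hρ, hρ1, hρ2⟩ := exists_multiplier (sig := sig) hom0 hsig hA
    (mul_le_mul_of_nonneg_left (Real.le_sqrt_of_sq_le hsG) hom0)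
    (le_mul_of_one_le_right hom0 (Real.one_le_sqrt.2 hG)) hsA hL1 hcondL
  have hm : 0 < ρ - 1 := by linarith
  have hr : 0 < ρ * B ^ 2 / μ := by positivity
  refine ⟨ρ * B ^ 2 / μ, 1 - A ^ 2 - ρ * g ^ 2 - A ^ 2 / (ρ - 1), hr, ?_, ?_⟩
  · rw [sub_pos, div_lt_iff₀ hm]; linarith
  intro a t T Q hT hQ
  have hrest : -(W ^ 2 * B ^ 2 * G / μ * a ^ 2) ≤ μ * Q + 2 * W * B * a * T := by
    have h3 : T ^ 2 ≤ G * Q := hT.trans (mul_le_mul_of_nonneg_right hS hQ)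
    have h4 : (W * B * T) ^ 2 ≤ μ * (W ^ 2 * B ^ 2 * G / μ * Q) := by
      have : μ * (W ^ 2 * B ^ 2 * G / μ * Q) = (W * B) ^ 2 * (G * Q) := by field_simp
      rw [this, mul_pow]
      exact mul_le_mul_of_nonneg_left h3 (sq_nonneg _)
    have h5 : (W * B * T) ^ 2 ≤ (μ * Q) * (W ^ 2 * B ^ 2 * G / μ) := by linarith
    rcases hQ.eq_or_lt with rfl | hQ'
    · have hT0 : T = 0 := by nlinarith
      have : 0 ≤ W ^ 2 * B ^ 2 * G / μ * a ^ 2 := by positivity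
      rw [hT0]; linarith
    · have := quadratic_form_nonneg (mul_pos hμ hQ') h5 a 1
      linarith
  have hmain := quadratic_form_nonneg (β := A * (ρ * om * sig - 1)) (γ := A ^ 2 / (ρ - 1)) hm
    (by rw [mul_div_cancel₀ _ hm.ne', mul_pow]; exact hρ2) a (B * t)
  have h6 := mul_le_mul_of_nonneg_left hrest hr.le
  have e3 : ρ * B ^ 2 / μ * (W ^ 2 * B ^ 2 * G / μ * a ^ 2) = ρ * g ^ 2 * a ^ 2 := by
    rw [hg2, hom]; field_simp
  have e4 : ρ * B ^ 2 / μ * (μ * t ^ 2) = ρ * (B * t) ^ 2 := by field_simp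
  have e5 : ρ * B ^ 2 / μ * (2 * W * B * a * (A * sig * t))
      = 2 * A * (ρ * om * sig) * a * (B * t) := by rw [hom]; field_simp
  rw [mul_neg, e3] at h6
  calc _ ≤ ρ * (B * t) ^ 2 + 2 * A * (ρ * om * sig) * a * (B * t) - ρ * g ^ 2 * a ^ 2 := by
        linarith
    _ ≤ _ := by rw [← e4, ← e5]; linarith

/-- Without a sign on `W` there is no cancellation to use. The factor `2` in `r = 2 l / μ` supplies
`l (t² + Q)` twice: one copy pays for `(A a + B t)²` by Young's inequality, the other for the whole
cross term, whence the constant `4`. -/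
theorem exists_dissipation {A B W μ l S G sig : ℝ} (hμ : 0 < μ)
    (h1 : l > B ^ 2) (h2 : B ^ 2 > 0) (hS : S + A ^ 2 * sig ^ 2 ≤ G) (hS0 : 0 ≤ S)
    (hcond : A ^ 2 * l / (l - B ^ 2) + 4 * l * B ^ 2 * W ^ 2 / μ ^ 2 * G < 1) :
    ∃ r ε : ℝ, 0 < r ∧ 0 < ε ∧ ∀ a t T Q : ℝ, T ^ 2 ≤ S * Q → 0 ≤ Q →
      (A * a + B * t) ^ 2 - (1 - ε) * a ^ 2
        ≤ r * (μ * (t ^ 2 + Q) + 2 * W * B * a * (A * sig * t + T)) := by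
  have hl : 0 < l := h2.trans h1
  have hd : 0 < l - B ^ 2 := by linarith
  have hr : 0 < 2 * l / μ := by positivity
  refine ⟨2 * l / μ, 1 - (A ^ 2 * l / (l - B ^ 2) + 4 * l * B ^ 2 * W ^ 2 / μ ^ 2 * G), hr,
    by linarith, ?_⟩
  intro a t T Q hT hQ
  set P := A * sig * t + T with hP
  have hP2 : P ^ 2 ≤ G * (t ^ 2 + Q) := by
    have h3 : P ^ 2 ≤ (S + A ^ 2 * sig ^ 2) * (t ^ 2 + Q) := by
      have h4 : 2 * (A * sig * t) * T ≤ S * t ^ 2 + A ^ 2 * sig ^ 2 * Q := by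
        have h5 : ((A * sig * t) * T) ^ 2 ≤ (S * t ^ 2) * (A ^ 2 * sig ^ 2 * Q) := by
          nlinarith [mul_le_mul_of_nonneg_left hT (sq_nonneg (A * sig * t))]
        have h6 : 0 ≤ S * t ^ 2 := by positivity
        have h7 : 0 ≤ A ^ 2 * sig ^ 2 * Q := by positivity
        nlinarith [abs_le_of_sq_le_sq' (a := 2 * ((A * sig * t) * T))
          (b := S * t ^ 2 + A ^ 2 * sig ^ 2 * Q)
          (by nlinarith [sq_nonneg (S * t ^ 2 - A ^ 2 * sig ^ 2 * Q)]) (by positivity)]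
      nlinarith
    exact h3.trans (mul_le_mul_of_nonneg_right hS (by positivity))
  have hyoung : (A * a + B * t) ^ 2 ≤ A ^ 2 * l / (l - B ^ 2) * a ^ 2 + l * t ^ 2 := by
    have := quadratic_form_nonneg (α := l - B ^ 2) (β := -(A * B))
      (γ := A ^ 2 * l / (l - B ^ 2) - A ^ 2) hd
      (by rw [mul_sub, mul_div_cancel₀ _ hd.ne']; nlinarith) a t
    linarith
  have hG0 : 0 ≤ G := le_trans (by positivity) hS
  have hrest : 0 ≤ l * (t ^ 2 + Q) + 2 * (2 * l / μ * W * B * P) * a * 1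
      + 4 * l * B ^ 2 * W ^ 2 / μ ^ 2 * G * a ^ 2 := by
    have hn : 0 ≤ t ^ 2 + Q := by positivity
    rcases hn.eq_or_lt with h0 | h0
    · have hP0 : P = 0 := by rw [← h0] at hP2; nlinarith
      rw [← h0, hP0]
      have : 0 ≤ 4 * l * B ^ 2 * W ^ 2 / μ ^ 2 * G * a ^ 2 := by positivity
      linarith
    · have := quadratic_form_nonneg (β := 2 * l / μ * W * B * P)
        (γ := 4 * l * B ^ 2 * W ^ 2 / μ ^ 2 * G) (mul_pos hl h0) (by
          have e : l * (t ^ 2 + Q) * (4 * l * B ^ 2 * W ^ 2 / μ ^ 2 * G)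
            = (2 * l / μ * W * B) ^ 2 * (G * (t ^ 2 + Q)) := by field_simp; ring
          rw [e, mul_pow _ P]
          exact mul_le_mul_of_nonneg_left hP2 (sq_nonneg _)) a 1
      linarith
  have e1 : 2 * l / μ * (μ * (t ^ 2 + Q) + 2 * W * B * a * P)
      = 2 * (l * (t ^ 2 + Q)) + 2 * (2 * l / μ * W * B * P) * a * 1 := by
    field_simp
  rw [e1]
  have : l * t ^ 2 ≤ l * (t ^ 2 + Q) := by nlinarith
  linarith

/-! ### From weighted contraction to asymptotic stability. -/

/-- A map of a weighted Euclidean space that contracts the weighted norm has a globally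
asymptotically stable equilibrium. -/
theorem exists_isGloballyAsymptoticallyStable {V : Type*} [Fintype V]
    {f : EuclideanSpace ℝ V → EuclideanSpace ℝ V} {p : V → ℝ} (hp : ∀ v, 0 < p v) {γ : ℝ}
    (hγ0 : 0 < γ) (hγ1 : γ < 1)
    (hf : ∀ x y, ∑ v, p v * (f x v - f y v) ^ 2 ≤ γ * ∑ v, p v * (x v - y v) ^ 2) :
    ∃ xbar, IsGloballyAsymptoticallyStable f xbar := by
  obtain ⟨a, ha, hpa⟩ : ∃ a : ℝ, 0 < a ∧ ∀ v, a ≤ p v := by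
    rcases isEmpty_or_nonempty V with h | h
    · exact ⟨1, one_pos, fun v => isEmptyElim v⟩
    · obtain ⟨v, hv⟩ := Finite.exists_min p
      exact ⟨p v, hp v, hv⟩
  obtain ⟨b, hb, hpb⟩ : ∃ b : ℝ, 0 < b ∧ ∀ v, p v ≤ b := by
    rcases isEmpty_or_nonempty V with h | h
    · exact ⟨1, one_pos, fun v => isEmptyElim v⟩
    · obtain ⟨v, hv⟩ := Finite.exists_max p
      exact ⟨p v, hp v, hv⟩
  have hiter : ∀ (t : ℕ) x y, ∑ v, p v * (f^[t] x v - f^[t] y v) ^ 2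
      ≤ γ ^ t * ∑ v, p v * (x v - y v) ^ 2 := fun t => by
    induction t with
    | zero => simp
    | succ t ih =>
      intro x y
      rw [Function.iterate_succ_apply', Function.iterate_succ_apply', pow_succ', mul_assoc]
      exact (hf _ _).trans (mul_le_mul_of_nonneg_left (ih x y) hγ0.le)
  have hnorm : ∀ x y : EuclideanSpace ℝ V, ‖x - y‖ ^ 2 = ∑ v, (x v - y v) ^ 2 := fun x y => by
    simp [EuclideanSpace.norm_sq_eq, sq_abs]
  set M := √(b / a) with hM
  have hM0 : 0 < M := Real.sqrt_pos.2 (div_pos hb ha)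
  set c := √γ with hc
  have hc0 : 0 < c := Real.sqrt_pos.2 hγ0
  have hc1 : c < 1 := by rw [hc, Real.sqrt_lt' one_pos]; simpa using hγ1
  have hbound : ∀ (t : ℕ) x y, ‖f^[t] x - f^[t] y‖ ≤ M * c ^ t * ‖x - y‖ := fun t x y => by
    refine (pow_le_pow_iff_left₀ (norm_nonneg _) (by positivity) two_ne_zero).1 ?_
    have h1 : a * ‖f^[t] x - f^[t] y‖ ^ 2 ≤ ∑ v, p v * (f^[t] x v - f^[t] y v) ^ 2 := by
      rw [hnorm, Finset.mul_sum]
      exact Finset.sum_le_sum fun v _ => mul_le_mul_of_nonneg_right (hpa v) (sq_nonneg _)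
    have h2 : ∑ v, p v * (x v - y v) ^ 2 ≤ b * ‖x - y‖ ^ 2 := by
      rw [hnorm, Finset.mul_sum]
      exact Finset.sum_le_sum fun v _ => mul_le_mul_of_nonneg_right (hpb v) (sq_nonneg _)
    have h3 : (M * c ^ t * ‖x - y‖) ^ 2 = γ ^ t * (b * ‖x - y‖ ^ 2) / a := by
      rw [mul_pow, mul_pow, ← pow_mul, mul_comm t 2, pow_mul, hM, hc, Real.sq_sqrt hγ0.le,
        Real.sq_sqrt (div_pos hb ha).le]
      ring
    rw [h3, le_div_iff₀ ha, mul_comm]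
    exact h1.trans ((hiter t x y).trans (mul_le_mul_of_nonneg_left h2 (by positivity)))
  -- Changing norms costs the factor `M`, so perhaps only an iterate of `f` contracts the Euclidean
  -- norm; the fixed point of that iterate is also fixed by `f`.
  obtain ⟨n, hn⟩ : ∃ n : ℕ, M * c ^ n < 1 := by
    obtain ⟨n, hn⟩ := exists_pow_lt_of_lt_one (inv_pos.2 hM0) hc1
    exact ⟨n, by rwa [← lt_inv_mul_iff₀ hM0, mul_one]⟩
  have hcontr : ContractingWith ⟨M * c ^ n, by positivity⟩ f^[n] :=
    ⟨by exact_mod_cast hn, LipschitzWith.of_dist_le_mul fun x y => by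
      rw [dist_eq_norm, dist_eq_norm]; exact hbound n x y⟩
  have hfix : f (hcontr.fixedPoint f^[n]) = hcontr.fixedPoint f^[n] :=
    hcontr.isFixedPt_fixedPoint_iterate
  refine ⟨_, hfix, fun r t => M * r * c ^ t, ⟨?_, ?_, ?_, ?_, ?_, ?_⟩, fun x t => ?_⟩
  · intro r t hr _
    positivity
  · refine Continuous.continuousOn ?_
    exact (continuous_const.mul continuous_fst).mul
      (Continuous.rpow continuous_const continuous_snd fun _ => Or.inl hc0.ne')
  · intro t _
    simp
  · intro t _ r _ r' _ h
    have := Real.rpow_pos_of_pos hc0 t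
    exact mul_lt_mul_of_pos_right (mul_lt_mul_of_pos_left h hM0) this
  · intro r hr t _ t' _ h
    exact mul_lt_mul_of_pos_left (Real.rpow_lt_rpow_of_exponent_gt hc0 hc1 h) (mul_pos hM0 hr)
  · intro r _
    simpa using (tendsto_rpow_atTop_of_base_lt_one c (by linarith) hc1).const_mul (M * r)
  · have := hbound t x (hcontr.fixedPoint f^[n])
    rw [Function.iterate_fixed hfix] at this
    simpa [Real.rpow_natCast, mul_right_comm] using this

/-! ### Joint continuity of partial derivatives. -/

/-- For a function that is convex and differentiable in one coordinate and jointly continuous,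
the partial derivative in that coordinate is jointly continuous. -/
theorem continuous_deriv_update {V : Type*} [DecidableEq V] {ell : (V → ℝ) → ℝ}
    (hcont : Continuous ell) {v : V}
    (hconv : ∀ z, ConvexOn ℝ Set.univ fun a => ell (Function.update z v a))
    (hdiff : ∀ z, Differentiable ℝ fun a => ell (Function.update z v a)) :
    Continuous fun z => deriv (fun a => ell (Function.update z v a)) (z v) := by
  -- Convexity places the derivative between left and right difference quotients. For fixed `h`
  -- these are continuous in `z`, so they give lower and upper semicontinuity respectively.
  have hquot : ∀ h : ℝ, Continuous fun z : V → ℝ =>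
      (ell (Function.update z v (z v + h)) - ell z) / h := fun h => by fun_prop
  have hslope : ∀ (z : V → ℝ) (h : ℝ), slope (fun a => ell (Function.update z v a)) (z v)
      (z v + h) = (ell (Function.update z v (z v + h)) - ell z) / h := fun z h => by
    simp [slope_def_field]
  have hlimit : ∀ z : V → ℝ, Filter.Tendsto
      (fun h : ℝ => (ell (Function.update z v (z v + h)) - ell z) / h) (nhdsWithin 0 {0}ᶜ)
      (nhds (deriv (fun a => ell (Function.update z v a)) (z v))) := fun z => by
    have := (hdiff z (z v)).hasDerivAt.tendsto_slope_zero
    simpa [div_eq_inv_mul] using this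
  have hright : ∀ (z : V → ℝ) (h : ℝ), 0 < h →
      deriv (fun a => ell (Function.update z v a)) (z v)
        ≤ (ell (Function.update z v (z v + h)) - ell z) / h := fun z h hh => by
    rw [← hslope]
    exact (hconv z).deriv_le_slope (Set.mem_univ _) (Set.mem_univ _) (by linarith)
      (hdiff z (z v))
  have hleft : ∀ (z : V → ℝ) (h : ℝ), h < 0 →
      (ell (Function.update z v (z v + h)) - ell z) / h
        ≤ deriv (fun a => ell (Function.update z v a)) (z v) := fun z h hh => by
    rw [← hslope, slope_comm]
    exact (hconv z).slope_le_deriv (Set.mem_univ _) (Set.mem_univ _) (by linarith)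
      (hdiff z (z v))
  rw [continuous_iff_continuousAt]
  intro z
  rw [ContinuousAt, tendsto_order]
  constructor
  · intro a ha
    have h1 := ((hlimit z).mono_left (nhdsWithin_mono 0
      (show Set.Iio (0 : ℝ) ⊆ {0}ᶜ from fun h hh => ne_of_lt hh))).eventually (lt_mem_nhds ha)
    obtain ⟨h, hah, hh⟩ := (h1.and self_mem_nhdsWithin).exists
    filter_upwards [((hquot h).tendsto z).eventually (lt_mem_nhds hah)] with y hy
    exact hy.trans_le (hleft y h hh)
  · intro a ha
    have h1 := ((hlimit z).mono_left (nhdsWithin_mono 0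
      (show Set.Ioi (0 : ℝ) ⊆ {0}ᶜ from fun h hh => ne_of_gt hh))).eventually (gt_mem_nhds ha)
    obtain ⟨h, hah, hh⟩ := (h1.and self_mem_nhdsWithin).exists
    filter_upwards [((hquot h).tendsto z).eventually (gt_mem_nhds hah)] with y hy
    exact (hright y h hh).trans_lt hy

/-! ### Predicted states and their effect on the gradient. -/

namespace ScalarGame

variable {V : Type*} (G : ScalarGame V)

theorem predState_eq_add {K : ℕ} (v : V) (α : ℝ) (s : EuclideanSpace ℝ (Fin K)) (k : ℕ) :
    G.predState v α s k = G.A v ^ k * α + G.predState v 0 s k := by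
  induction k with
  | zero => simp [predState]
  | succ k ih => rw [predState, predState, ih]; ring

theorem contDiff_predState {K : ℕ} (v : V) (α : ℝ) (k : ℕ) :
    ContDiff ℝ 1 fun s : EuclideanSpace ℝ (Fin K) => G.predState v α s k := by
  induction k with
  | zero => exact contDiff_const
  | succ k ih =>
    simp only [predState]
    refine (contDiff_const.mul ih).add (contDiff_const.mul ?_)
    split_ifs
    · fun_prop
    · exact contDiff_const

/-- The sensitivity of `∑ k, Aᵏ xₖ` with respect to the `j`-th input (up to the factor `B`). -/
noncomputable def sensitivity (K : ℕ) (v : V) (j : ℕ) : ℝ :=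
  G.A v ^ (j + 1) * ∑ i ∈ Finset.range (K - 1 - j), (G.A v ^ 2) ^ i

theorem sum_pow_mul_predState {K : ℕ} (v : V) (s : EuclideanSpace ℝ (Fin K)) :
    ∑ k : Fin K, G.A v ^ (k : ℕ) * G.predState v 0 s k
      = G.B v * ∑ j : Fin K, G.sensitivity K v j * s j := by
  set e : ℕ → ℝ := fun k => if h : k < K then s ⟨k, h⟩ else 0 with he
  have hpred : ∀ k, G.predState v 0 s k
      = G.B v * ∑ j ∈ Finset.range k, G.A v ^ (k - 1 - j) * e j := fun k => by
    induction k with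
    | zero => simp [predState]
    | succ k ih =>
      rw [predState, ih, Finset.sum_range_succ, mul_add, mul_left_comm, Finset.mul_sum]
      congr 2
      · refine Finset.sum_congr rfl fun j hj => ?_
        have : k + 1 - 1 - j = (k - 1 - j) + 1 := by
          have := Finset.mem_range.1 hj; omega
        rw [this, pow_succ]; ring
      · simp [he]
  have hsum : ∀ n, ∑ k ∈ Finset.range n, G.A v ^ k * G.predState v 0 s k
      = G.B v * ∑ j ∈ Finset.range n, G.sensitivity n v j * e j := fun n => by
    induction n with
    | zero => simp
    | succ n ih =>
      rw [Finset.sum_range_succ, ih, hpred, Finset.sum_range_succ]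
      -- The last input only moves the terminal state, which carries no cost.
      have h0 : G.sensitivity (n + 1) v n = 0 := by simp [sensitivity]
      rw [h0, zero_mul, add_zero, mul_left_comm, ← mul_add, Finset.mul_sum,
        ← Finset.sum_add_distrib]
      congr 1
      refine Finset.sum_congr rfl fun j hj => ?_
      have hj' := Finset.mem_range.1 hj
      have h1 : n + 1 - 1 - j = (n - 1 - j) + 1 := by omega
      have h2 : G.A v ^ n * G.A v ^ (n - 1 - j)
          = G.A v ^ (j + 1) * (G.A v ^ 2) ^ (n - 1 - j) := by
        rw [← pow_mul, ← pow_add, ← pow_add]; congr 1; omega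
      rw [sensitivity, sensitivity, h1, Finset.sum_range_succ, ← mul_assoc, h2]
      ring
  have h1 := hsum K
  rw [← Fin.sum_univ_eq_sum_range (fun k => G.A v ^ k * G.predState v 0 s k),
    ← Fin.sum_univ_eq_sum_range (fun j => G.sensitivity K v j * e j)] at h1
  simpa [he] using h1

/-- The part of the cost that depends on the predicted states. -/
noncomputable def stateCost {K : ℕ} (v : V) (α : ℝ) (s : EuclideanSpace ℝ (Fin K)) : ℝ :=
  ∑ k : Fin K, (G.W v * G.predState v α s k ^ 2 + G.w v * G.predState v α s k)

theorem contDiff_stateCost {K : ℕ} (v : V) (α : ℝ) :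
    ContDiff ℝ 1 fun s : EuclideanSpace ℝ (Fin K) => G.stateCost v α s := by
  refine ContDiff.sum fun k _ => ?_
  have := G.contDiff_predState (K := K) v α k
  fun_prop

theorem continuous_gradient_stateCost {K : ℕ} (v : V) (α : ℝ) :
    Continuous (gradient fun s : EuclideanSpace ℝ (Fin K) => G.stateCost v α s) :=
  (InnerProductSpace.toDual ℝ _).symm.continuous.comp
    ((G.contDiff_stateCost v α).continuous_fderiv one_ne_zero)

/-- Since `xₖ = Aᵏ α + xₖ(0, s)`, the terms quadratic in `s` do not involve `α`. Thus the two costs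
differ by an affine function of `s`, whose linear part comes from `2 W (α - α') ∑ Aᵏ xₖ(0, s)`. -/
theorem gradient_stateCost_sub {K : ℕ} (v : V) (α α' : ℝ) (s : EuclideanSpace ℝ (Fin K)) :
    gradient (fun s => G.stateCost v α s) s - gradient (fun s => G.stateCost v α' s) s
      = (2 * G.W v * G.B v * (α - α')) •
        (WithLp.toLp 2 fun j : Fin K => G.sensitivity K v j : EuclideanSpace ℝ (Fin K)) := by
  set c : EuclideanSpace ℝ (Fin K) := (2 * G.W v * G.B v * (α - α')) •
    (WithLp.toLp 2 fun j : Fin K => G.sensitivity K v j : EuclideanSpace ℝ (Fin K)) with hc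
  set κ : ℝ := ∑ k : Fin K, (G.W v * ((G.A v ^ (k : ℕ) * α) ^ 2 - (G.A v ^ (k : ℕ) * α') ^ 2)
    + G.w v * (G.A v ^ (k : ℕ) * (α - α'))) with hκ
  have hfun : (fun s : EuclideanSpace ℝ (Fin K) => G.stateCost v α s)
      = fun s => G.stateCost v α' s + (InnerProductSpace.toDual ℝ _ c s + κ) := by
    funext s
    have h1 : InnerProductSpace.toDual ℝ _ c s
        = 2 * G.W v * (α - α') * ∑ k : Fin K, G.A v ^ (k : ℕ) * G.predState v 0 s k := by
      rw [sum_pow_mul_predState, InnerProductSpace.toDual_apply_apply, hc, real_inner_smul_left,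
        PiLp.inner_apply]
      simp only [RCLike.inner_apply, conj_trivial]
      simp only [mul_comm (s _)]
      ring
    rw [h1, hκ, Finset.mul_sum, ← Finset.sum_add_distrib, stateCost, stateCost,
      ← Finset.sum_add_distrib]
    refine Finset.sum_congr rfl fun k _ => ?_
    rw [G.predState_eq_add v α, G.predState_eq_add v α']
    ring
  have hd : HasGradientAt (fun s => G.stateCost v α' s)
      (gradient (fun s => G.stateCost v α' s) s) s :=
    (((G.contDiff_stateCost v α').differentiable one_ne_zero) s).hasGradientAt
  have hl : HasGradientAt
      (fun s => G.stateCost v α' s + (InnerProductSpace.toDual ℝ _ c s + κ))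
      (gradient (fun s => G.stateCost v α' s) s + c) s := by
    rw [hasGradientAt_iff_hasFDerivAt, map_add] at *
    exact hd.add (((InnerProductSpace.toDual ℝ _ c).hasFDerivAt).add_const κ)
  rw [hfun, hl.gradient, add_sub_cancel_left]

/-! ### The constraint set over the horizon. -/

theorem horizonZ_eq_image (K : ℕ) :
    G.horizonZ K = (fun z : Fin K → V → ℝ => (WithLp.toLp 2 fun v => WithLp.toLp 2 fun k => z k v :
      Profile V K)) '' Set.univ.pi fun _ => G.Z := by
  ext u
  constructor
  · exact fun hu => ⟨fun k => stageInput u k, fun k _ => hu k, rfl⟩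
  · rintro ⟨z, hz, rfl⟩ k
    exact hz k (Set.mem_univ k)

theorem isCompact_horizonZ (h : IsCompact G.Z) (K : ℕ) : IsCompact (G.horizonZ K) := by
  rw [horizonZ_eq_image]
  exact (isCompact_univ_pi fun _ => h).image (by fun_prop)

theorem nonempty_horizonZ (h : G.Z.Nonempty) (K : ℕ) : (G.horizonZ K).Nonempty := by
  rw [horizonZ_eq_image]
  exact (Set.univ_pi_nonempty_iff.2 fun _ => h).image _

theorem convex_Z (hC : Convex ℝ G.C) (hU : ∀ v, Convex ℝ (G.U v)) : Convex ℝ G.Z :=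
  fun _ hx _ hy _ _ ha hb hab =>
    ⟨fun v => hU v (hx.1 v) (hy.1 v) ha hb hab, hC hx.2 hy.2 ha hb hab⟩

theorem convex_horizonZ (h : Convex ℝ G.Z) (K : ℕ) : Convex ℝ (G.horizonZ K) :=
  fun _ hx _ hy _ _ ha hb hab k => h (hx k) (hy k) ha hb hab

/-! ### From the stability conditions to dissipation. -/

/-- Dissipation inequality of a single agent under the stability condition. -/
theorem exists_agent_dissipation (K : ℕ) [NeZero K] (hK : 1 < K) {μ : ℝ} (hμ : 0 < μ) (v : V)
    (hA : |G.A v| < 1)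
    (hcond : ∃ l₁ l₂ : ℝ, 0 ≤ l₁ ∧ 0 ≤ l₂ ∧
      ((0 ≤ G.W v ∧ μ > (G.B v) ^ 2 / l₁ ∧ (G.B v) ^ 2 / l₁ > 0 ∧
          μ * l₁ * (G.A v) ^ 2 / (μ * l₁ - (G.B v) ^ 2)
            + l₁ * (G.B v) ^ 2 * (G.W v) ^ 2 / μ
              * ∑ k ∈ Finset.range (K - 1), (((k : ℝ) + 1) * (G.A v) ^ k) ^ 2 < 1) ∨
        (l₂ > (G.B v) ^ 2 ∧ (G.B v) ^ 2 > 0 ∧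
          (G.A v) ^ 2 * l₂ / (l₂ - (G.B v) ^ 2)
            + 4 * l₂ * (G.B v) ^ 2 * (G.W v) ^ 2 / μ ^ 2
              * ∑ k ∈ Finset.range (K - 1), (((k : ℝ) + 1) * (G.A v) ^ k) ^ 2 < 1))) :
    ∃ r ε : ℝ, 0 < r ∧ 0 < ε ∧ ∀ (a : ℝ) (s : Fin K → ℝ),
      (G.A v * a + G.B v * s 0) ^ 2 - (1 - ε) * a ^ 2
        ≤ r * (μ * ∑ j, s j ^ 2 + 2 * G.W v * G.B v * a
          * ∑ j : Fin K, G.sensitivity K v j * s j) := by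
  set q := G.A v ^ 2 with hq
  have hq0 : 0 ≤ q := sq_nonneg _
  have hq1 : q < 1 := (sq_lt_one_iff_abs_lt_one _).2 hA
  set Γ := ∑ k ∈ Finset.range (K - 1), (((k : ℝ) + 1) * (G.A v) ^ k) ^ 2 with hΓ
  have hΓ' : Γ = ∑ k ∈ Finset.range (K - 1), ((k : ℝ) + 1) ^ 2 * q ^ k :=
    Finset.sum_congr rfl fun k _ => by rw [mul_pow, hq, ← pow_mul, ← pow_mul, mul_comm k 2]
  set σ := ∑ i ∈ Finset.range (K - 1), q ^ i with hσ
  have hσ0 : 0 ≤ σ := Finset.sum_nonneg fun i _ => pow_nonneg hq0 i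
  have hσΓ : σ ^ 2 ≤ Γ := hΓ' ▸ geom_sum_sq_le hq0 hq1.le (K - 1)
  have hσq : σ * (1 - q) ≤ 1 := by
    rw [hσ, geom_sum_mul_neg]
    linarith [pow_nonneg hq0 (K - 1)]
  have hΓ1 : 1 ≤ Γ := by
    rw [hΓ']
    refine le_trans (by simp) (Finset.single_le_sum (f := fun k : ℕ => ((k : ℝ) + 1) ^ 2 * q ^ k)
      (fun k _ => by positivity) (Finset.mem_range.2 (Nat.sub_pos_of_lt hK)))
  have hc0 : G.sensitivity K v ((0 : Fin K) : ℕ) = G.A v * σ := by simp [sensitivity, hσ, hq]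
  -- The index `0` is kept apart because only the first input also enters the true dynamics.
  set S := ∑ j ∈ Finset.univ.erase (0 : Fin K), G.sensitivity K v j ^ 2 with hS
  have hS0 : 0 ≤ S := Finset.sum_nonneg fun j _ => sq_nonneg _
  have hSΓ : S + q * σ ^ 2 ≤ Γ := by
    have h1 : S + q * σ ^ 2 = ∑ j : Fin K, G.sensitivity K v j ^ 2 := by
      rw [← Finset.sum_erase_add _ _ (Finset.mem_univ (0 : Fin K)), hc0, mul_pow]
    have h2 : ∑ j ∈ Finset.range K, G.sensitivity K v j ^ 2
        = ∑ j ∈ Finset.range (K - 1),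
          q ^ (j + 1) * (∑ i ∈ Finset.range (K - 1 - j), q ^ i) ^ 2 := by
      conv_lhs => rw [← Nat.sub_add_cancel hK.le, Finset.sum_range_succ]
      rw [Nat.sub_add_cancel hK.le]
      have h3 : G.sensitivity K v (K - 1) = 0 := by simp [sensitivity]
      rw [h3]
      simp only [ne_eq, OfNat.ofNat_ne_zero, not_false_eq_true, zero_pow, add_zero]
      refine Finset.sum_congr rfl fun j _ => ?_
      rw [sensitivity, mul_pow, ← hq, ← pow_mul, mul_comm (j + 1) 2, pow_mul]
    rw [h1, Fin.sum_univ_eq_sum_range (fun j => G.sensitivity K v j ^ 2), h2, hΓ']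
    exact sum_pow_mul_geom_sq_le hq0 hq1.le _
  have hex : ∃ r ε : ℝ, 0 < r ∧ 0 < ε ∧ ∀ a t T Q : ℝ, T ^ 2 ≤ S * Q → 0 ≤ Q →
      (G.A v * a + G.B v * t) ^ 2 - (1 - ε) * a ^ 2
        ≤ r * (μ * (t ^ 2 + Q) + 2 * G.W v * G.B v * a * (G.A v * σ * t + T)) := by
    obtain ⟨l₁, l₂, hl₁, -, ⟨hW, h1, h2, h3⟩ | ⟨h1, h2, h3⟩⟩ := hcond
    · exact exists_dissipation_of_nonneg hμ hA hW hl₁ h1 h2 hΓ1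
        (by nlinarith [mul_nonneg hq0 (sq_nonneg σ)]) hσ0 hσΓ hσq h3
    · exact exists_dissipation hμ h1 h2 hSΓ hS0 h3
  obtain ⟨r, ε, hr, hε, h⟩ := hex
  refine ⟨r, ε, hr, hε, fun a s => ?_⟩
  have h1 := h a (s 0) (∑ j ∈ Finset.univ.erase (0 : Fin K), G.sensitivity K v j * s j)
    (∑ j ∈ Finset.univ.erase (0 : Fin K), s j ^ 2) (Finset.sum_mul_sq_le_sq_mul_sq _ _ _)
    (Finset.sum_nonneg fun j _ => sq_nonneg _)
  rwa [← hc0, Finset.add_sum_erase _ (fun j : Fin K => s j ^ 2) (Finset.mem_univ _),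
    Finset.add_sum_erase _ (fun j : Fin K => G.sensitivity K v j * s j) (Finset.mem_univ _)] at h1

/-! ### Structure and continuity of the pseudo-gradient. -/

variable [DecidableEq V]

theorem J_update {K : ℕ} (v : V) (u : Profile V K) (a : EuclideanSpace ℝ (Fin K))
    (x : EuclideanSpace ℝ V) :
    G.J v (WithLp.toLp 2 (Function.update u.ofLp v a)) x
      = G.stateCost v (x v) a + ∑ k, G.ell v (Function.update (stageInput u k) v (a k)) := by
  have h : ∀ k, stageInput (WithLp.toLp 2 (Function.update u.ofLp v a) : Profile V K) k
      = Function.update (stageInput u k) v (a k) := fun k => by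
    funext v'
    by_cases hv : v' = v
    · subst hv; simp [stageInput]
    · simp [stageInput, hv]
  simp [J, stateCost, h, Finset.sum_add_distrib]

theorem exists_mem_ocpFeasibleSet {K : ℕ} {u : Profile V K} (hu : u ∈ G.horizonZ K)
    (x : EuclideanSpace ℝ V) (v : V) :
    ∃ ξ : Fin (K + 1) → ℝ, (u v, ξ) ∈ G.ocpFeasibleSet v x u := by
  refine ⟨fun k => G.predState v (x v) (u v) k, rfl, fun k => ⟨?_, (hu k).1 v, ?_⟩⟩
  · simp [predState]
  · have : (WithLp.toLp 2 (Function.update u.ofLp v (u v)) : Profile V K) = u := by simp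
    rw [this]
    exact (hu k).2

/-- The state appears only in the first summand, so the input cost drops out when two states are
compared. -/
theorem pseudoGradient_apply
    (hdiff : ∀ (v : V) (z : V → ℝ), Differentiable ℝ fun a => G.ell v (Function.update z v a))
    {K : ℕ} (u : Profile V K) (x : EuclideanSpace ℝ V) (v : V) :
    G.pseudoGradient u x v = gradient (fun s => G.stateCost v (x v) s) (u v)
      + WithLp.toLp 2 fun k =>
        deriv (fun a => G.ell v (Function.update (stageInput u k) v a)) (stageInput u k v) := by
  simp only [pseudoGradient, J_update]
  refine HasGradientAt.gradient ?_
  have hd : HasGradientAt (fun s => G.stateCost v (x v) s)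
      (gradient (fun s => G.stateCost v (x v) s) (u v)) (u v) :=
    (((G.contDiff_stateCost v (x v)).differentiable one_ne_zero) (u v)).hasGradientAt
  rw [hasGradientAt_iff_hasFDerivAt] at hd ⊢
  rw [map_add]
  refine hd.add ?_
  have hk : ∀ k : Fin K, HasFDerivAt
      (fun s : EuclideanSpace ℝ (Fin K) => G.ell v (Function.update (stageInput u k) v (s k)))
      (deriv (fun a => G.ell v (Function.update (stageInput u k) v a)) (stageInput u k v)
        • EuclideanSpace.proj (𝕜 := ℝ) k) (u v) := fun k =>
    (hdiff v (stageInput u k) (u v k)).hasDerivAt.comp_hasFDerivAt (u v)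
      (f := fun s : EuclideanSpace ℝ (Fin K) => s k)
      (EuclideanSpace.proj (𝕜 := ℝ) k : EuclideanSpace ℝ (Fin K) →L[ℝ] ℝ).hasFDerivAt
  convert HasFDerivAt.fun_sum (u := Finset.univ) fun k _ => hk k using 1
  ext s
  simp [PiLp.inner_apply, mul_comm]

theorem continuous_pseudoGradient {K : ℕ}
    (hcont : ∀ v, Continuous (G.ell v))
    (hconv : ∀ (v : V) (z : V → ℝ),
      ConvexOn ℝ Set.univ fun a => G.ell v (Function.update z v a))
    (hdiff : ∀ (v : V) (z : V → ℝ), Differentiable ℝ fun a => G.ell v (Function.update z v a))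
    (x : EuclideanSpace ℝ V) : Continuous fun u : Profile V K => G.pseudoGradient u x := by
  have hcomp : ∀ v, Continuous fun u : Profile V K => G.pseudoGradient u x v := fun v => by
    simp only [G.pseudoGradient_apply hdiff]
    refine ((G.continuous_gradient_stateCost v (x v)).comp (by fun_prop)).add ?_
    refine (PiLp.continuous_toLp 2 _).comp (continuous_pi fun k => ?_)
    have hs : Continuous fun u : Profile V K => stageInput u k := by
      unfold stageInput; fun_prop
    exact (continuous_deriv_update (hcont v) (hconv v) (hdiff v)).comp hs
  exact (PiLp.continuous_toLp 2 _).comp (continuous_pi hcomp)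

theorem pseudoGradient_sub
    (hdiff : ∀ (v : V) (z : V → ℝ), Differentiable ℝ fun a => G.ell v (Function.update z v a))
    {K : ℕ} (u : Profile V K) (x x' : EuclideanSpace ℝ V) (v : V) :
    G.pseudoGradient u x v - G.pseudoGradient u x' v
      = (2 * G.W v * G.B v * (x v - x' v)) •
        (WithLp.toLp 2 fun j : Fin K => G.sensitivity K v j : EuclideanSpace ℝ (Fin K)) := by
  rw [G.pseudoGradient_apply hdiff, G.pseudoGradient_apply hdiff, add_sub_add_right_eq_sub,
    gradient_stateCost_sub]

/-! ### Variational equilibria and the closed loop. -/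

variable [Fintype V]

theorem mem_solutionSet_iff {K : ℕ} {x : EuclideanSpace ℝ V} {u : Profile V K} :
    u ∈ G.solutionSet K x ↔ u ∈ G.horizonZ K ∧
      ∀ y ∈ G.horizonZ K, 0 ≤ inner ℝ (G.pseudoGradient u x) (y - u) := by
  constructor
  · rintro ⟨g, ⟨hu, hg⟩, h⟩
    refine ⟨hu, fun y hy => ?_⟩
    have := hg y hy
    rw [eq_neg_of_add_eq_zero_right h, inner_neg_left] at this
    linarith
  · rintro ⟨hu, h⟩
    refine ⟨-G.pseudoGradient u x, ⟨hu, fun y hy => ?_⟩, add_neg_cancel _⟩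
    rw [inner_neg_left]
    linarith [h y hy]

namespace StandingAssumptions

variable {G} {K : ℕ} {μ : ℝ}

theorem differentiable_ell (hG : G.StandingAssumptions K μ) (v : V) (z : V → ℝ) :
    Differentiable ℝ fun a => G.ell v (Function.update z v a) :=
  (hG.contDiff_ell v z).differentiable one_ne_zero

theorem convexOn_ell (hG : G.StandingAssumptions K μ) (v : V) (z : V → ℝ) :
    ConvexOn ℝ Set.univ fun a => G.ell v (Function.update z v a) := by
  obtain ⟨m, hm, h⟩ := hG.strongConvex_ell v z
  exact strongConvexOn_zero.1 (h.mono hm.le)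

/-- Dissipation inequality between the equilibria at two states. -/
theorem solutionSet_sensitivity (hG : G.StandingAssumptions K μ) {x x' : EuclideanSpace ℝ V}
    {u u' : Profile V K} (hu : u ∈ G.solutionSet K x) (hu' : u' ∈ G.solutionSet K x') :
    ∑ v, (μ * ∑ j, (u v j - u' v j) ^ 2 + 2 * G.W v * G.B v * (x v - x' v)
      * ∑ j : Fin K, G.sensitivity K v j * (u v j - u' v j)) ≤ 0 := by
  rw [mem_solutionSet_iff] at hu hu'
  have h1 := hu.2 u' hu'.1
  have h2 := hu'.2 u hu.1
  have h3 := (hG.stronglyMonotone x').2 u u'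
  have h4 : inner ℝ (G.pseudoGradient u x - G.pseudoGradient u x') (u - u')
      = ∑ v, 2 * G.W v * G.B v * (x v - x' v)
      * ∑ j : Fin K, G.sensitivity K v j * (u v j - u' v j) := by
    rw [PiLp.inner_apply]
    refine Finset.sum_congr rfl fun v _ => ?_
    rw [PiLp.sub_apply, G.pseudoGradient_sub hG.differentiable_ell, real_inner_smul_left,
      PiLp.inner_apply]
    simp [mul_comm]
  have h5 : ‖u - u'‖ ^ 2 = ∑ v, ∑ j, (u v j - u' v j) ^ 2 := by
    simp [PiLp.norm_sq_eq_of_L2, sq_abs]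
  rw [real_inner_comm, h5, inner_sub_left] at h3
  rw [inner_sub_left] at h4
  rw [← neg_sub u u', inner_neg_right] at h1
  rw [Finset.sum_add_distrib, ← Finset.mul_sum, ← h4]
  linarith

theorem existsUnique_mem_solutionSet (hG : G.StandingAssumptions K μ) (x : EuclideanSpace ℝ V) :
    ∃! u : Profile V K, u ∈ G.solutionSet K x := by
  obtain ⟨hμ, hmono⟩ := hG.stronglyMonotone x
  obtain ⟨u, hu, h⟩ := exists_variationalInequality_solution
    (G.convex_horizonZ (G.convex_Z hG.convex_C hG.convex_U) K)
    (G.isCompact_horizonZ hG.isCompact_Z K) (G.nonempty_horizonZ hG.nonempty_Z K)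
    (G.continuous_pseudoGradient hG.continuous_ell hG.convexOn_ell hG.differentiable_ell x)
    (fun y _ z _ => by
      have := hmono y z
      rw [real_inner_comm] at this
      exact le_trans (by positivity) this)
  refine ⟨u, G.mem_solutionSet_iff.2 ⟨hu, h⟩, fun u' hu' => ?_⟩
  replace hu' := G.mem_solutionSet_iff.1 hu'
  have h1 := h u' hu'.1
  have h2 := hu'.2 u hu
  have h3 := hmono u' u
  rw [real_inner_comm, inner_sub_left] at h3
  rw [← neg_sub, inner_neg_right] at h2
  have h4 : μ * ‖u' - u‖ ^ 2 ≤ 0 := by linarith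
  have h5 : ‖u' - u‖ ^ 2 ≤ 0 := nonpos_of_mul_nonpos_right h4 hμ
  exact sub_eq_zero.1 (norm_eq_zero.1 (pow_eq_zero_iff two_ne_zero |>.1
    (le_antisymm h5 (sq_nonneg _))))

theorem vGNE_mem (hG : G.StandingAssumptions K μ) (x : EuclideanSpace ℝ V) :
    G.vGNE K x ∈ G.solutionSet K x :=
  Classical.epsilon_spec (hG.existsUnique_mem_solutionSet x).exists

theorem vGNE_mem_horizonZ (hG : G.StandingAssumptions K μ) (x : EuclideanSpace ℝ V) :
    G.vGNE K x ∈ G.horizonZ K :=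
  (G.mem_solutionSet_iff.1 (hG.vGNE_mem x)).1

end StandingAssumptions

/-- The closed loop has a globally asymptotically stable equilibrium whenever each agent satisfies
a dissipation inequality. -/
theorem exists_isGloballyAsymptoticallyStable_closedLoop {K : ℕ} [NeZero K] {μ : ℝ}
    (hG : G.StandingAssumptions K μ)
    (hdis : ∀ v, ∃ r ε : ℝ, 0 < r ∧ 0 < ε ∧ ∀ (a : ℝ) (s : Fin K → ℝ),
      (G.A v * a + G.B v * s 0) ^ 2 - (1 - ε) * a ^ 2
        ≤ r * (μ * ∑ j, s j ^ 2 + 2 * G.W v * G.B v * a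
          * ∑ j : Fin K, G.sensitivity K v j * s j)) :
    ∃ xbar, IsGloballyAsymptoticallyStable (G.closedLoop K) xbar := by
  choose r ε hr hε h using hdis
  -- The floor `1 / 2` keeps `γ` positive even if some `ε v ≥ 1`, as the strictly decreasing KL
  -- bound requires.
  obtain ⟨γ, hγ0, hγ1, hγ⟩ : ∃ γ : ℝ, 0 < γ ∧ γ < 1 ∧ ∀ v, 1 - ε v ≤ γ := by
    rcases isEmpty_or_nonempty V with hV | hV
    · exact ⟨1 / 2, by norm_num, by norm_num, fun v => isEmptyElim v⟩
    · obtain ⟨v, hv⟩ := Finite.exists_min ε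
      exact ⟨max (1 / 2) (1 - ε v), lt_max_of_lt_left (by norm_num),
        max_lt (by norm_num) (by linarith [hε v]),
        fun v' => le_max_of_le_right (by linarith [hv v'])⟩
  refine _root_.exists_isGloballyAsymptoticallyStable (p := fun v => (r v)⁻¹)
    (fun v => inv_pos.2 (hr v)) hγ0 hγ1 fun x y => ?_
  have hs := hG.solutionSet_sensitivity (hG.vGNE_mem x) (hG.vGNE_mem y)
  have hv : ∀ v, (r v)⁻¹ * (G.closedLoop K x v - G.closedLoop K y v) ^ 2
      ≤ γ * ((r v)⁻¹ * (x v - y v) ^ 2)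
        + (μ * ∑ j, (G.vGNE K x v j - G.vGNE K y v j) ^ 2 + 2 * G.W v * G.B v * (x v - y v)
      * ∑ j : Fin K, G.sensitivity K v j * (G.vGNE K x v j - G.vGNE K y v j)) := fun v => by
    have h1 := h v (x v - y v) fun j => G.vGNE K x v j - G.vGNE K y v j
    have h2 : G.closedLoop K x v - G.closedLoop K y v = G.A v * (x v - y v)
        + G.B v * (G.vGNE K x v 0 - G.vGNE K y v 0) := by
      simp only [closedLoop, feedback, stageInput]; ring
    have h3 := mul_le_mul_of_nonneg_right (hγ v) (sq_nonneg (x v - y v))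
    rw [← h2] at h1
    rw [inv_mul_le_iff₀ (hr v), mul_add, mul_left_comm γ, mul_inv_cancel_left₀ (hr v).ne']
    linarith
  -- The agents' supply terms need not be nonpositive one by one; the weights `1 / r` make them add
  -- up to the sum bounded in `hs`.
  calc _ ≤ _ := Finset.sum_le_sum fun v _ => hv v
    _ ≤ _ := by rw [Finset.sum_add_distrib, ← Finset.mul_sum]; linarith

end ScalarGame

theorem corollary2 {V : Type*} [Fintype V] [DecidableEq V] (K : ℕ) [NeZero K] (hK : 1 < K)
    (G : ScalarGame V) (μ : ℝ) (hG : G.StandingAssumptions K μ)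
    (hcond : ∀ v : V, ∃ l₁ l₂ : ℝ, 0 ≤ l₁ ∧ 0 ≤ l₂ ∧
      ((0 ≤ G.W v ∧ μ > (G.B v) ^ 2 / l₁ ∧ (G.B v) ^ 2 / l₁ > 0 ∧
          μ * l₁ * (G.A v) ^ 2 / (μ * l₁ - (G.B v) ^ 2)
            + l₁ * (G.B v) ^ 2 * (G.W v) ^ 2 / μ
              * ∑ k ∈ Finset.range (K - 1), (((k : ℝ) + 1) * (G.A v) ^ k) ^ 2 < 1) ∨
        (l₂ > (G.B v) ^ 2 ∧ (G.B v) ^ 2 > 0 ∧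
          (G.A v) ^ 2 * l₂ / (l₂ - (G.B v) ^ 2)
            + 4 * l₂ * (G.B v) ^ 2 * (G.W v) ^ 2 / μ ^ 2
              * ∑ k ∈ Finset.range (K - 1), (((k : ℝ) + 1) * (G.A v) ^ k) ^ 2 < 1))) :
    -- the variational equilibrium, hence the closed loop, is well defined
    (∀ x : EuclideanSpace ℝ V, ∃! u : Profile V K, u ∈ G.solutionSet K x) ∧
    -- (i) a globally asymptotically stable equilibrium point exists
    (∃ xbar : EuclideanSpace ℝ V, IsGloballyAsymptoticallyStable (G.closedLoop K) xbar) ∧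
    -- (ii) recursive feasibility from every initial state
    (∀ (x₀ : EuclideanSpace ℝ V) (t : ℕ) (v : V), ∃ ξ : Fin (K + 1) → ℝ,
      (G.vGNE K ((G.closedLoop K)^[t] x₀) v, ξ) ∈
        G.ocpFeasibleSet v ((G.closedLoop K)^[t] x₀) (G.vGNE K ((G.closedLoop K)^[t] x₀))) ∧
    -- (iii) constraint satisfaction at all times
    (∀ (x₀ : EuclideanSpace ℝ V) (t : ℕ), G.feedback K ((G.closedLoop K)^[t] x₀) ∈ G.Z) := by
  refine ⟨hG.existsUnique_mem_solutionSet,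
    G.exists_isGloballyAsymptoticallyStable_closedLoop hG fun v => ?_,
    fun x₀ t v => G.exists_mem_ocpFeasibleSet (hG.vGNE_mem_horizonZ _) _ v,
    fun x₀ t => hG.vGNE_mem_horizonZ _ 0⟩
  exact G.exists_agent_dissipation K hK (hG.stronglyMonotone 0).1 v (hG.stable v) (hcond v)
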